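/- Let $\mathbb{D}$ be the open unit disc of $\mathbb{C}$, let $1\le p\le\infty$ and $0<R<1$ (with $1/p=0$ when $p=\infty$). Let $H^p$ be the Hardy space of holomorphic functions $g$ on $\mathbb{D}$ with $\|g\|_p<\infty$, where $\|g\|_p=\lim_{r\uparrow1}\left(\frac1{2\pi}\int_0^{2\pi}|g(re^{i\theta})|^p\,d\theta\right)^{1/p}$ for $p<\infty$ and $\|g\|_\infty=\lim_{r\uparrow 1}\sup_\theta|g(re^{i\theta})|$. For $E\subset\mathbb{D}$ and $\epsilon>0$ put $$C_p(E,\epsilon,R)=\sup\Big\{\sup_{|z|\le R}|g(z)| : g\in H^p,\ \|g\|_p\le 1,\ |g(\zeta)|\le\epsilon\ \ \forall \zeta\in E\Big\}.$$ Let $E_0$ be the set of nontangential limit points of $E$, that is, of the points $\zeta\in\partial\mathbb{D}$ for which there is a sequence $(z_n)$ in $E$ with $z_n\to\zeta$ and $|z_n-\zeta|=O(1-|z_n|)$. Let $\omega$ be the harmonic measure of $E_0$ with respect to $\mathbb{D}$, that is, $$\omega(z)=\frac1{2\pi}\int_0^{2\pi}\frac{1-|z|^2}{|e^{i\theta}-z|^2}\,\mathbf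 1_{E_0}(e^{i\theta})\,d\theta\qquad(z\in\mathbb{D}).$$ If $E_0$ has positive Lebesgue measure on $\partial\mathbb{D}$, then for every $\epsilon>0$ $$C_p(E,\epsilon,R)\le\frac{2^{1/p}}{(1-R^2)^{1/p}}\,\sup_{|z|\le R}\epsilon^{\omega(z)},$$ and, if moreover $\epsilon\le 1$, then also $\epsilon\le C_p(E,\epsilon,R)$. -/

import Mathlib

open MeasureTheory Filter Topology Metric
open scoped ENNReal

noncomputable section

/-- The set of nontangential limit points of `E`: the points `ζ` of the unit circle for which some
sequence `z n` in `E` satisfies `z n → ζ` and `|z n - ζ| = O(1 - |z n|)`. -/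
def nontangentialLimitPoints (E : Set ℂ) : Set ℂ :=
  {ζ | ζ ∈ sphere (0 : ℂ) 1 ∧ ∃ z : ℕ → ℂ, (∀ n, z n ∈ E) ∧ Tendsto z atTop (𝓝 ζ) ∧
    (fun n => z n - ζ) =O[atTop] (fun n => 1 - ‖z n‖)}

/-- Lebesgue (arc length) measure of a subset of the unit circle. -/
def circleMeasure (A : Set ℂ) : ℝ≥0∞ :=
  volume {θ : ℝ | θ ∈ Set.Ioc 0 (2 * Real.pi) ∧ circleMap 0 1 θ ∈ A}

/-- The normalized measure `dθ / 2π` on `(0, 2π]`. -/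
def angleMeasure : Measure ℝ :=
  ENNReal.ofReal (2 * Real.pi)⁻¹ • volume.restrict (Set.Ioc 0 (2 * Real.pi))

/-- The integral mean `((2π)⁻¹ ∫ |g (r e^{iθ})|^p dθ)^{1/p}`; for `p = ∞` and `g` continuous on the
circle of radius `r` it is the supremum of `|g|` on that circle. -/
def hardyMean (p : ℝ≥0∞) (g : ℂ → ℂ) (r : ℝ) : ℝ≥0∞ :=
  eLpNorm (fun θ : ℝ => g (circleMap 0 r θ)) p angleMeasure

/-- The Hardy norm, the limit as `r ↑ 1` of the integral means. For `g` holomorphic in the disc and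
`1 ≤ p` the means increase with `r`, so this upper limit is the limit. -/
def hardyNorm (p : ℝ≥0∞) (g : ℂ → ℂ) : ℝ≥0∞ :=
  limsup (hardyMean p g) (𝓝[<] (1 : ℝ))

/-- `g` belongs to the Hardy space `H^p` of the unit disc. -/
def MemHardy (p : ℝ≥0∞) (g : ℂ → ℂ) : Prop :=
  DifferentiableOn ℂ g (ball 0 1) ∧ hardyNorm p g < ∞

/-- `C_p(E, ε, R)`, the supremum of `sup_{|z| ≤ R} |g z|` over all `g` in the unit ball of `H^p` with
`|g| ≤ ε` on `E`, as an element of `[0, ∞]`. -/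
def stabilityConstant (p : ℝ≥0∞) (E : Set ℂ) (ε R : ℝ) : ℝ≥0∞ :=
  ⨆ g ∈ {g : ℂ → ℂ | MemHardy p g ∧ hardyNorm p g ≤ 1 ∧ ∀ ζ ∈ E, ‖g ζ‖ ≤ ε},
    ⨆ z ∈ closedBall (0 : ℂ) R, ‖g z‖ₑ

/-- The harmonic measure at the point `z` of the unit disc of a subset `A` of the unit circle:
the Poisson integral of the indicator function of `A`. -/
def discHarmonicMeasure (A : Set ℂ) (z : ℂ) : ℝ :=
  Real.circleAverage (fun ζ => poissonKernel 0 z ζ * A.indicator (fun _ => (1 : ℝ)) ζ) 0 1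

end

/-! This is a two constants argument. Let `W` be holomorphic with real part `ω` and put `h = g * ε ^
(-W)`, so that `|h| = |g| ε ^ (-ω)`. At almost every point of `E₀` the boundary value of `g` is at
most `ε` in modulus and `ω` tends to 1, hence `|h| ≤ 1`. Almost everywhere off `E₀`, `ω` tends to 0
and `|h| = |g|`. So the boundary mean of `|h|^p` is at most `1 + 1 = 2`, and the sharp growth
estimate `|h z|^p (1 - |z|^2) ≤ mean of |h|^p` gives the bound. The lower bound comes from the
constant function `ε`.

The boundary values come from Fatou's theorem (`ae_tendsto_integral_poissonKernel`), proved by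
dominating the Poisson kernel in a Stolz angle by an approximate identity at a Lebesgue point. It is
applied to bounded `g`, which is a Poisson integral by weak compactness in `L²`. A general `g` has
`|g| ≤ re U` with `U` holomorphic; then `g * exp (-η U)` is bounded, is dominated by `|g|`, and
tends to `g` as `η ↓ 0`. The case `p = ∞` is the limit of finite exponents. -/

/-! ### Normalized arc length and Poisson integrals -/

instance isProbabilityMeasure_angleMeasure : IsProbabilityMeasure angleMeasure := by
  constructor
  have h : (0 : ℝ) < 2 * Real.pi := by positivity
  rw [angleMeasure, Measure.smul_apply, Measure.restrict_apply MeasurableSet.univ, Set.univ_inter,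
    Real.volume_Ioc, sub_zero, smul_eq_mul, ← ENNReal.ofReal_mul (by positivity),
    inv_mul_cancel₀ h.ne', ENNReal.ofReal_one]

theorem angleMeasure_eq_smul_restrict :
    angleMeasure =
      ENNReal.ofReal (2 * Real.pi)⁻¹ • volume.restrict (Set.Ioc 0 (2 * Real.pi)) := rfl

theorem circleAverage_eq_integral_angleMeasure {E : Type*} [NormedAddCommGroup E]
    [NormedSpace ℝ E] (f : ℂ → E) (r : ℝ) :
    Real.circleAverage f 0 r = ∫ θ, f (circleMap 0 r θ) ∂angleMeasure := by
  rw [Real.circleAverage_def, intervalIntegral.integral_of_le (by positivity),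
    angleMeasure_eq_smul_restrict, integral_smul_measure, ENNReal.toReal_ofReal (by positivity)]

theorem circleIntegrable_iff_integrable_angleMeasure {E : Type*} [NormedAddCommGroup E]
    {f : ℂ → E} {r : ℝ} :
    CircleIntegrable f 0 r ↔ Integrable (fun θ => f (circleMap 0 r θ)) angleMeasure := by
  rw [CircleIntegrable, intervalIntegrable_iff_integrableOn_Ioc_of_le (by positivity),
    angleMeasure_eq_smul_restrict, integrable_smul_measure (by simp; positivity) (by simp),
    IntegrableOn]

theorem continuous_poissonKernel_circleMap {z : ℂ} (hz : ‖z‖ < 1) :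
    Continuous (fun θ : ℝ => poissonKernel 0 z (circleMap 0 1 θ)) := by
  simp only [poissonKernel_def, sub_zero]
  refine Continuous.div (by fun_prop) (by fun_prop) fun θ => ?_
  have : circleMap 0 1 θ - z ≠ 0 := by
    intro h
    rw [sub_eq_zero] at h
    rw [← h] at hz
    simp at hz
  positivity

theorem poissonKernel_circleMap_nonneg {z : ℂ} (hz : ‖z‖ < 1) (θ : ℝ) :
    0 ≤ poissonKernel 0 z (circleMap 0 1 θ) := by
  simp only [poissonKernel_def, sub_zero, norm_circleMap_zero, abs_one]
  have := norm_nonneg z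
  exact div_nonneg (by nlinarith) (by positivity)

theorem poissonKernel_circleMap_le {z : ℂ} (hz : ‖z‖ < 1) (θ : ℝ) :
    poissonKernel 0 z (circleMap 0 1 θ) ≤ (1 + ‖z‖) / (1 - ‖z‖) := by
  rw [poissonKernel_eq_re_herglotzRieszKernel]
  have := re_herglotzRieszKernel_le (c := 0) (R := 1) (z := circleMap 0 1 θ) (w := z) (by simp)
    (by simpa using hz)
  simpa [herglotzRieszKernel_def] using this

theorem integrable_poissonKernel_smul {E : Type*} [NormedAddCommGroup E] [NormedSpace ℝ E]
    {f : ℝ → E} (hf : Integrable f angleMeasure) {z : ℂ} (hz : ‖z‖ < 1) :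
    Integrable (fun θ => poissonKernel 0 z (circleMap 0 1 θ) • f θ) angleMeasure := by
  refine hf.bdd_smul (C := (1 + ‖z‖) / (1 - ‖z‖))
    (continuous_poissonKernel_circleMap hz).aestronglyMeasurable ?_
  refine Eventually.of_forall fun θ => ?_
  rw [Real.norm_of_nonneg (poissonKernel_circleMap_nonneg hz θ)]
  exact poissonKernel_circleMap_le hz θ

theorem integrable_angleMeasure_of_continuous {E : Type*} [NormedAddCommGroup E]
    {f : ℝ → E} (hf : Continuous f) : Integrable f angleMeasure := by
  rw [angleMeasure_eq_smul_restrict]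
  exact Integrable.smul_measure (hf.integrableOn_Ioc) (by simp)

theorem integral_poissonKernel_smul {k : ℂ → ℂ} (hk : DiffContOnCl ℂ k (ball 0 1)) {z : ℂ}
    (hz : ‖z‖ < 1) :
    ∫ θ, poissonKernel 0 z (circleMap 0 1 θ) • k (circleMap 0 1 θ) ∂angleMeasure = k z := by
  rw [← hk.circleAverage_poissonKernel_smul (w := z) (by simpa using hz),
    circleAverage_eq_integral_angleMeasure]
  rfl

theorem integral_poissonKernel {z : ℂ} (hz : ‖z‖ < 1) :
    ∫ θ, poissonKernel 0 z (circleMap 0 1 θ) ∂angleMeasure = 1 := by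
  have := integral_poissonKernel_smul (k := fun _ => 1) diffContOnCl_const hz
  simp only [Complex.real_smul, mul_one] at this
  rw [integral_complex_ofReal] at this
  exact_mod_cast this

theorem continuous_comp_circleMap {E : Type*} [TopologicalSpace E] {k : ℂ → E}
    (hk : ContinuousOn k (closedBall 0 1)) {r : ℝ} (hr₀ : 0 ≤ r) (hr₁ : r ≤ 1) :
    Continuous (fun θ => k (circleMap 0 r θ)) :=
  hk.comp_continuous (continuous_circleMap 0 r) fun θ => by
    simpa [abs_of_nonneg hr₀] using hr₁

/-- Jensen's inequality for the probability measure with Poisson density. -/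
theorem norm_rpow_le_integral_poissonKernel {k : ℂ → ℂ} (hk : DiffContOnCl ℂ k (ball 0 1)) {z : ℂ}
    (hz : ‖z‖ < 1) {p : ℝ} (hp : 1 ≤ p) :
    ‖k z‖ ^ p ≤
      ∫ θ, poissonKernel 0 z (circleMap 0 1 θ) * ‖k (circleMap 0 1 θ)‖ ^ p ∂angleMeasure := by
  set P : ℝ → ℝ := fun θ => poissonKernel 0 z (circleMap 0 1 θ) with hP
  have hPc : Continuous P := continuous_poissonKernel_circleMap hz
  have hP0 : ∀ θ, 0 ≤ P θ := poissonKernel_circleMap_nonneg hz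
  set Q : ℝ → NNReal := fun θ => (P θ).toNNReal with hQ
  have hQm : Measurable Q := hPc.measurable.real_toNNReal
  set ν : Measure ℝ := angleMeasure.withDensity fun θ => (Q θ : ℝ≥0∞) with hν
  have hint : ∀ f : ℝ → ℝ, ∫ θ, f θ ∂ν = ∫ θ, P θ * f θ ∂angleMeasure := by
    intro f
    rw [hν, integral_withDensity_eq_integral_smul hQm]
    refine integral_congr_ae (Eventually.of_forall fun θ => ?_)
    simp [hQ, NNReal.smul_def, Real.coe_toNNReal _ (hP0 θ)]
  have hintb : ∀ f : ℝ → ℝ, Continuous f → Integrable f ν := by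
    intro f hf
    rw [hν, integrable_withDensity_iff_integrable_smul hQm]
    exact integrable_angleMeasure_of_continuous
      ((continuous_real_toNNReal.comp hPc).smul hf)
  have : IsProbabilityMeasure ν := by
    constructor
    rw [hν, withDensity_apply _ MeasurableSet.univ, Measure.restrict_univ]
    have h1 := ofReal_integral_eq_lintegral_ofReal
      (integrable_angleMeasure_of_continuous hPc) (Eventually.of_forall hP0)
    rw [integral_poissonKernel hz, ENNReal.ofReal_one] at h1
    exact h1.symm
  have hc : Continuous fun θ => ‖k (circleMap 0 1 θ)‖ := by
    refine (continuous_comp_circleMap ?_ zero_le_one le_rfl).norm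
    rw [← closure_ball _ one_ne_zero]
    exact hk.continuousOn
  have hc' : Continuous fun θ => ‖k (circleMap 0 1 θ)‖ ^ p :=
    hc.rpow_const fun _ => Or.inr (by linarith)
  have hJ := (convexOn_rpow hp).map_integral_le (μ := ν)
    (f := fun θ => ‖k (circleMap 0 1 θ)‖)
    (continuousOn_id.rpow_const fun _ _ => Or.inr (by linarith)) isClosed_Ici
    (Eventually.of_forall fun _ => norm_nonneg _) (hintb _ hc) (hintb _ hc')
  simp only [hint] at hJ
  refine le_trans (Real.rpow_le_rpow (norm_nonneg _) ?_ (by linarith)) hJ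
  rw [← integral_poissonKernel_smul hk hz]
  refine (norm_integral_le_integral_norm _).trans_eq ?_
  refine integral_congr_ae (Eventually.of_forall fun θ => ?_)
  simp only [norm_smul, Real.norm_of_nonneg (poissonKernel_circleMap_nonneg hz θ)]
  rfl

/-! ### The sharp growth estimate -/

theorem diffContOnCl_comp_mul {g : ℂ → ℂ} (hg : DifferentiableOn ℂ g (ball 0 1)) {r : ℝ}
    (hr₀ : 0 ≤ r) (hr₁ : r < 1) : DiffContOnCl ℂ (fun w => g (r * w)) (ball 0 1) := by
  refine DifferentiableOn.diffContOnCl ?_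
  rw [closure_ball _ one_ne_zero]
  refine hg.comp (by fun_prop) fun w hw => ?_
  simp only [mem_closedBall, dist_zero_right, mem_ball, norm_mul, Complex.norm_real,
    Real.norm_of_nonneg hr₀] at hw ⊢
  nlinarith [norm_nonneg w]

theorem mul_circleMap_one (r θ : ℝ) : (r : ℂ) * circleMap 0 1 θ = circleMap 0 r θ := by
  simp [circleMap_zero]

/-- The growth estimate for Hardy spaces with its sharp constant, on the disc of radius `r`. -/
theorem norm_rpow_mul_le_integral {g : ℂ → ℂ} (hg : DifferentiableOn ℂ g (ball 0 1)) {r : ℝ}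
    (hr₀ : 0 ≤ r) (hr₁ : r < 1) {z : ℂ} (hz : ‖z‖ < 1) {p : ℝ} (hp : 1 ≤ p) :
    ‖g (r * z)‖ ^ p * (1 - ‖z‖ ^ 2) ≤ ∫ θ, ‖g (circleMap 0 r θ)‖ ^ p ∂angleMeasure := by
  have hp0 : 0 < p := by linarith
  have hz2 : 0 < 1 - ‖z‖ ^ 2 := by nlinarith [norm_nonneg z]
  -- On the circle the Poisson kernel at `z` is `(1 - |z|^2) / |s|^2`. Multiplying `g` by `q = s ^
  -- (2 / p)` therefore cancels the denominator, while `|q z|^p = (1 - |z|^2)^2`. The power is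
  -- holomorphic because `re s > 0` on the closed disc.
  set s : ℂ → ℂ := fun w => 1 - (starRingEnd ℂ) z * w with hs
  have hslit : ∀ w, ‖w‖ ≤ 1 → s w ∈ Complex.slitPlane := by
    intro w hw
    refine Or.inl ?_
    have h1 : ((starRingEnd ℂ) z * w).re ≤ ‖z‖ * ‖w‖ := by
      refine (Complex.re_le_norm _).trans_eq ?_
      rw [norm_mul, RCLike.norm_conj]
    have h2 : ‖z‖ * ‖w‖ ≤ ‖z‖ := mul_le_of_le_one_right (norm_nonneg _) hw
    simp only [hs, Complex.sub_re, Complex.one_re]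
    linarith
  set q : ℂ → ℂ := fun w => s w ^ ((2 / p : ℝ) : ℂ) with hq
  have hqd : DiffContOnCl ℂ q (ball 0 1) := by
    refine DifferentiableOn.diffContOnCl ?_
    rw [closure_ball _ one_ne_zero]
    intro w hw
    refine DifferentiableAt.differentiableWithinAt ?_
    exact DifferentiableAt.cpow (by fun_prop) (by fun_prop) (hslit w (by simpa using hw))
  have hqn : ∀ w, ‖w‖ ≤ 1 → ‖q w‖ ^ p = ‖s w‖ ^ 2 := by
    intro w hw
    have h0 : s w ≠ 0 := Complex.slitPlane_ne_zero (hslit w hw)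
    rw [hq]
    simp only
    rw [Complex.norm_cpow_real, ← Real.rpow_mul (norm_nonneg _), div_mul_cancel₀ _ hp0.ne']
    norm_num
  have hk := (diffContOnCl_comp_mul hg hr₀ hr₁).smul hqd
  have key := norm_rpow_le_integral_poissonKernel hk hz hp
  have hsz : ‖s z‖ = 1 - ‖z‖ ^ 2 := by
    have : s z = ((1 - ‖z‖ ^ 2 : ℝ) : ℂ) := by
      simp only [hs]
      rw [mul_comm, Complex.mul_conj, Complex.normSq_eq_norm_sq]
      push_cast
      ring
    rw [this, Complex.norm_real, Real.norm_of_nonneg hz2.le]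
  have hR : ∀ θ : ℝ, poissonKernel 0 z (circleMap 0 1 θ) *
      ‖g (r * circleMap 0 1 θ) • q (circleMap 0 1 θ)‖ ^ p =
      (1 - ‖z‖ ^ 2) * ‖g (circleMap 0 r θ)‖ ^ p := by
    intro θ
    have hsn : ‖s (circleMap 0 1 θ)‖ = ‖circleMap 0 1 θ - z‖ := by
      have h1 : s (circleMap 0 1 θ) =
          (starRingEnd ℂ) (circleMap 0 1 θ - z) * circleMap 0 1 θ := by
        have : (starRingEnd ℂ) (circleMap 0 1 θ) * circleMap 0 1 θ = 1 := by
          rw [mul_comm, Complex.mul_conj, Complex.normSq_eq_norm_sq]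
          simp
        simp only [hs, map_sub, sub_mul, this]
      rw [h1, norm_mul, RCLike.norm_conj]
      simp
    have hne : ‖circleMap 0 1 θ - z‖ ≠ 0 := by
      rw [← hsn, norm_ne_zero_iff]
      exact Complex.slitPlane_ne_zero (hslit _ (by simp))
    rw [norm_smul, Real.mul_rpow (norm_nonneg _) (norm_nonneg _), hqn _ (by simp), hsn,
      mul_circleMap_one, poissonKernel_def]
    simp only [sub_zero, norm_circleMap_zero, abs_one]
    field_simp
  simp only [hR] at key
  rw [integral_const_mul, norm_smul, Real.mul_rpow (norm_nonneg _) (norm_nonneg _),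
    hqn z hz.le, hsz] at key
  nlinarith

/-! ### Weak limits of dilates: majorants and boundary functions -/

/-- Bounded families of functionals have pointwise limits along ultrafilters. -/
theorem exists_strongDual_tendsto_of_norm_le {V ι : Type*} [SeminormedAddCommGroup V]
    [NormedSpace ℂ V] (𝒰 : Ultrafilter ι) (Λ : ι → StrongDual ℂ V) (C : ℝ)
    (h : ∀ᶠ i in (𝒰 : Filter ι), ‖Λ i‖ ≤ C) :
    ∃ L : StrongDual ℂ V, ∀ v, Tendsto (fun i => Λ i v) 𝒰 (𝓝 (L v)) := by
  have hc := WeakDual.isCompact_closedBall (𝕜 := ℂ) (0 : StrongDual ℂ V) C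
  obtain ⟨L, -, hL⟩ := hc.ultrafilter_le_nhds (𝒰.map fun i => StrongDual.toWeakDual (Λ i)) (by
    rw [le_principal_iff, Ultrafilter.coe_map, mem_map]
    filter_upwards [h] with i hi
    simpa using hi)
  refine ⟨WeakDual.toStrongDual L, fun v => ?_⟩
  have h1 : Tendsto (fun i => StrongDual.toWeakDual (Λ i)) 𝒰 (𝓝 L) := hL
  exact ((WeakDual.eval_continuous v).tendsto L).comp h1

/-- The inclusion of the unit circle into the plane. -/
noncomputable def circleInclusion : C(Circle, ℂ) := ⟨fun x => (x : ℂ), by fun_prop⟩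

/-- The Herglotz–Riesz kernel as an element of the algebra of continuous functions on the circle. -/
noncomputable def herglotzRieszMap (z : ℂ) : C(Circle, ℂ) :=
  (circleInclusion + algebraMap ℂ C(Circle, ℂ) z) *
    Ring.inverse (circleInclusion - algebraMap ℂ C(Circle, ℂ) z)

theorem circleInclusion_apply (x : Circle) : circleInclusion x = x := rfl

theorem isUnit_circleInclusion_sub {z : ℂ} (hz : ‖z‖ < 1) :
    IsUnit (circleInclusion - algebraMap ℂ C(Circle, ℂ) z) := by
  rw [ContinuousMap.isUnit_iff_forall_ne_zero]
  intro x hx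
  have : (x : ℂ) = z := by simpa [circleInclusion_apply, sub_eq_zero] using hx
  rw [← this] at hz
  exact absurd hz (by rw [Circle.norm_coe]; exact lt_irrefl 1)

theorem herglotzRieszMap_apply {z : ℂ} (hz : ‖z‖ < 1) (x : Circle) :
    herglotzRieszMap z x = herglotzRieszKernel 0 z x := by
  have h1 := congrArg (fun φ : C(Circle, ℂ) => φ x)
    (Ring.mul_inverse_cancel _ (isUnit_circleInclusion_sub hz))
  simp only [ContinuousMap.mul_apply, ContinuousMap.one_apply] at h1
  rw [herglotzRieszMap, ContinuousMap.mul_apply, eq_inv_of_mul_eq_one_right h1,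
    herglotzRieszKernel_def]
  simp [circleInclusion_apply, div_eq_mul_inv]

/-- Holomorphy in `z` with values in `C(Circle, ℂ)` makes `L (herglotzRieszMap z)` holomorphic for
every continuous functional `L`, in particular for a weak-* limit of densities. -/
theorem differentiableAt_herglotzRieszMap {z : ℂ} (hz : ‖z‖ < 1) :
    DifferentiableAt ℂ herglotzRieszMap z := by
  have ha : Differentiable ℂ (fun z => algebraMap ℂ C(Circle, ℂ) z) := by
    simp only [Algebra.algebraMap_eq_smul_one]
    fun_prop
  refine DifferentiableAt.mul (by fun_prop) ?_
  exact (differentiableAt_inverse (isUnit_circleInclusion_sub hz)).comp z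
    (f := fun z => circleInclusion - algebraMap ℂ C(Circle, ℂ) z) (by fun_prop)

theorem exists_strongDual_eq_integral {f : ℝ → ℂ} (hf : Integrable f angleMeasure) :
    ∃ Λ : StrongDual ℂ C(Circle, ℂ), ‖Λ‖ ≤ ∫ θ, ‖f θ‖ ∂angleMeasure ∧
      ∀ φ, Λ φ = ∫ θ, φ (Circle.exp θ) * f θ ∂angleMeasure := by
  have hi : ∀ φ : C(Circle, ℂ), Integrable (fun θ => φ (Circle.exp θ) * f θ) angleMeasure := by
    intro φ
    refine hf.bdd_mul (c := ‖φ‖) ?_ (Eventually.of_forall fun θ => φ.norm_coe_le_norm _)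
    exact (φ.continuous.comp Circle.exp.continuous).aestronglyMeasurable
  let Λ : C(Circle, ℂ) →ₗ[ℂ] ℂ :=
    { toFun := fun φ => ∫ θ, φ (Circle.exp θ) * f θ ∂angleMeasure
      map_add' := fun φ ψ => by
        rw [← integral_add (hi φ) (hi ψ)]
        simp [add_mul]
      map_smul' := fun c φ => by
        rw [RingHom.id_apply, smul_eq_mul, ← integral_const_mul]
        simp [mul_assoc] }
  have hb : ∀ φ, ‖Λ φ‖ ≤ (∫ θ, ‖f θ‖ ∂angleMeasure) * ‖φ‖ := by
    intro φ
    refine (norm_integral_le_integral_norm _).trans ?_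
    rw [mul_comm, ← integral_const_mul]
    refine integral_mono (hi φ).norm (hf.norm.const_mul _) fun θ => ?_
    simp only [norm_mul]
    gcongr
    exact φ.norm_coe_le_norm _
  exact ⟨Λ.mkContinuous _ hb,
    Λ.mkContinuous_norm_le (integral_nonneg fun _ => norm_nonneg _) hb, fun φ => rfl⟩

theorem exp_eq_circleMap (θ : ℝ) : (Circle.exp θ : ℂ) = circleMap 0 1 θ := by
  simp [circleMap_zero]

theorem continuous_comp_circleMap_of_lt {g : ℂ → ℂ} (hg : DifferentiableOn ℂ g (ball 0 1)) {r : ℝ}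
    (hr₀ : 0 ≤ r) (hr₁ : r < 1) : Continuous (fun θ => g (circleMap 0 r θ)) :=
  hg.continuousOn.comp_continuous (continuous_circleMap 0 r) fun θ => by
    simpa [abs_of_nonneg hr₀] using hr₁

theorem integral_poissonKernel_smul_dilation {g : ℂ → ℂ} (hg : DifferentiableOn ℂ g (ball 0 1))
    {r : ℝ} (hr₀ : 0 ≤ r) (hr₁ : r < 1) {z : ℂ} (hz : ‖z‖ < 1) :
    ∫ θ, poissonKernel 0 z (circleMap 0 1 θ) • g (circleMap 0 r θ) ∂angleMeasure = g (r * z) := by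
  rw [← integral_poissonKernel_smul (diffContOnCl_comp_mul hg hr₀ hr₁) hz]
  simp only [mul_circleMap_one]

theorem eventually_nhdsLT_one : ∀ᶠ r : ℝ in 𝓝[<] (1 : ℝ), 0 < r ∧ r < 1 :=
  Ioo_mem_nhdsLT (by norm_num)

theorem tendsto_dilation {g : ℂ → ℂ} (hg : DifferentiableOn ℂ g (ball 0 1)) {z : ℂ}
    (hz : ‖z‖ < 1) : Tendsto (fun r : ℝ => g (r * z)) (𝓝[<] 1) (𝓝 (g z)) := by
  have h1 : ContinuousAt g z :=
    (hg.differentiableAt (isOpen_ball.mem_nhds (by simpa using hz))).continuousAt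
  have h2 : Tendsto (fun r : ℝ => (r : ℂ) * z) (𝓝[<] 1) (𝓝 z) := by
    have : Continuous fun r : ℝ => (r : ℂ) * z := by fun_prop
    simpa using (this.tendsto 1).mono_left nhdsWithin_le_nhds
  exact h1.tendsto.comp h2

/-- A function in `H¹` has modulus bounded by the real part of a holomorphic function. -/
theorem exists_norm_le_re_of_integral_le {g : ℂ → ℂ} (hg : DifferentiableOn ℂ g (ball 0 1)) (C : ℝ)
    (hC : ∀ᶠ r in 𝓝[<] (1 : ℝ), ∫ θ, ‖g (circleMap 0 r θ)‖ ∂angleMeasure ≤ C) :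
    ∃ U : ℂ → ℂ, DifferentiableOn ℂ U (ball 0 1) ∧ ∀ z ∈ ball (0 : ℂ) 1, ‖g z‖ ≤ (U z).re := by
  have hex : ∀ r : ℝ, ∃ Λ : StrongDual ℂ C(Circle, ℂ), 0 < r ∧ r < 1 →
      ‖Λ‖ ≤ ∫ θ, ‖g (circleMap 0 r θ)‖ ∂angleMeasure ∧
      ∀ φ, Λ φ = ∫ θ, φ (Circle.exp θ) * (‖g (circleMap 0 r θ)‖ : ℂ) ∂angleMeasure := by
    intro r
    by_cases hr : 0 < r ∧ r < 1
    · have hc : Continuous fun θ => (‖g (circleMap 0 r θ)‖ : ℂ) :=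
        Complex.continuous_ofReal.comp (continuous_comp_circleMap_of_lt hg hr.1.le hr.2).norm
      obtain ⟨Λ, h1, h2⟩ :=
        exists_strongDual_eq_integral (integrable_angleMeasure_of_continuous hc)
      exact ⟨Λ, fun _ => ⟨by simpa using h1, h2⟩⟩
    · exact ⟨0, fun h => absurd h hr⟩
  choose Λ hΛ using hex
  -- The functionals with densities `|g (r e^{iθ})|` are bounded in norm by `C`, so they converge
  -- weak-* along an ultrafilter finer than `r ↑ 1`; no subsequence is needed.
  let 𝒰 : Ultrafilter ℝ := Ultrafilter.of (𝓝[<] (1 : ℝ))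
  have h𝒰 : (𝒰 : Filter ℝ) ≤ 𝓝[<] 1 := Ultrafilter.of_le _
  obtain ⟨L, hL⟩ := exists_strongDual_tendsto_of_norm_le 𝒰 Λ C (by
    filter_upwards [h𝒰 hC, h𝒰 eventually_nhdsLT_one] with r h1 h2
    exact (hΛ r h2).1.trans h1)
  refine ⟨fun z => L (herglotzRieszMap z), fun z hz => ?_, fun z hz => ?_⟩
  · have hz' : ‖z‖ < 1 := by simpa using hz
    exact (L.differentiableAt.comp z (differentiableAt_herglotzRieszMap hz')).differentiableWithinAt
  · have hz' : ‖z‖ < 1 := by simpa using hz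
    have h1 : Tendsto (fun r => (Λ r (herglotzRieszMap z)).re) 𝒰
        (𝓝 (L (herglotzRieszMap z)).re) :=
      (Complex.continuous_re.tendsto _).comp (hL _)
    refine le_of_tendsto_of_tendsto ((tendsto_dilation hg hz').norm.mono_left h𝒰) h1 ?_
    filter_upwards [h𝒰 eventually_nhdsLT_one] with r hr
    have hc : Continuous fun θ => ‖g (circleMap 0 r θ)‖ :=
      (continuous_comp_circleMap_of_lt hg hr.1.le hr.2).norm
    have hint : Integrable (fun θ => herglotzRieszMap z (Circle.exp θ) *
        (‖g (circleMap 0 r θ)‖ : ℂ)) angleMeasure := by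
      refine integrable_angleMeasure_of_continuous ?_
      exact ((herglotzRieszMap z).continuous.comp Circle.exp.continuous).mul
        (Complex.continuous_ofReal.comp hc)
    -- The density is real, so the real part of the pairing is the Poisson integral of `|g (r
    -- e^{iθ})|`, which dominates `|g (r z)|`.
    rw [(hΛ r hr).2, ← integral_poissonKernel_smul_dilation hg hr.1.le hr.2 hz']
    have h2 := Complex.reCLM.integral_comp_comm hint
    simp only [Complex.reCLM_apply] at h2
    rw [← h2]
    refine (norm_integral_le_integral_norm _).trans_eq ?_
    refine integral_congr_ae (Eventually.of_forall fun θ => ?_)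
    simp only [norm_smul, Real.norm_of_nonneg (poissonKernel_circleMap_nonneg hz' θ)]
    rw [Complex.re_mul_ofReal, herglotzRieszMap_apply hz', exp_eq_circleMap,
      poissonKernel_eq_re_herglotzRieszKernel, Function.comp_apply]

/-- A bounded holomorphic function is the Poisson integral of an integrable function. -/
theorem exists_eq_integral_poissonKernel {g : ℂ → ℂ} (hg : DifferentiableOn ℂ g (ball 0 1)) {M : ℝ}
    (hM : ∀ z ∈ ball (0 : ℂ) 1, ‖g z‖ ≤ M) :
    ∃ f : ℝ → ℂ, Integrable f angleMeasure ∧ ∀ z ∈ ball (0 : ℂ) 1,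
      ∫ θ, poissonKernel 0 z (circleMap 0 1 θ) • f θ ∂angleMeasure = g z := by
  have hM0 : 0 ≤ M := (norm_nonneg _).trans (hM 0 (by simp))
  have hex : ∀ r : ℝ, ∃ v : Lp ℂ 2 angleMeasure, 0 < r ∧ r < 1 →
      ‖v‖ ≤ M ∧ v =ᵐ[angleMeasure] fun θ => g (circleMap 0 r θ) := by
    intro r
    by_cases hr : 0 < r ∧ r < 1
    · have hc := continuous_comp_circleMap_of_lt hg hr.1.le hr.2
      have hb : ∀ θ, ‖g (circleMap 0 r θ)‖ ≤ M := fun θ =>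
        hM _ (by simpa [abs_of_pos hr.1] using hr.2)
      have hm : MemLp (fun θ => g (circleMap 0 r θ)) 2 angleMeasure :=
        MemLp.of_bound hc.aestronglyMeasurable M (Eventually.of_forall hb)
      refine ⟨hm.toLp _, fun _ => ⟨?_, hm.coeFn_toLp⟩⟩
      rw [Lp.norm_toLp]
      refine ENNReal.toReal_le_of_le_ofReal hM0 ?_
      refine (eLpNorm_le_of_ae_bound (Eventually.of_forall hb)).trans_eq ?_
      simp
    · exact ⟨0, fun h => absurd h hr⟩
  choose v hv using hex
  let 𝒰 : Ultrafilter ℝ := Ultrafilter.of (𝓝[<] (1 : ℝ))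
  have h𝒰 : (𝒰 : Filter ℝ) ≤ 𝓝[<] 1 := Ultrafilter.of_le _
  obtain ⟨L, hL⟩ := exists_strongDual_tendsto_of_norm_le 𝒰 (fun r => innerSL ℂ (v r)) M (by
    filter_upwards [h𝒰 eventually_nhdsLT_one] with r h2
    simpa using (hv r h2).1)
  set f : Lp ℂ 2 angleMeasure := (InnerProductSpace.toDual ℂ _).symm L with hf
  have hfL : ∀ w, L w = inner ℂ f w := fun w =>
    (InnerProductSpace.toDual_symm_apply (x := w) (y := L)).symm
  refine ⟨f, (Lp.memLp f).integrable (by norm_num), fun z hz => ?_⟩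
  have hz' : ‖z‖ < 1 := by simpa using hz
  have hPc := continuous_poissonKernel_circleMap hz'
  have hPm : MemLp (fun θ : ℝ => (poissonKernel 0 z (circleMap 0 1 θ) : ℂ)) 2 angleMeasure := by
    refine MemLp.of_bound (Complex.continuous_ofReal.comp hPc).aestronglyMeasurable
      ((1 + ‖z‖) / (1 - ‖z‖)) (Eventually.of_forall fun θ => ?_)
    rw [Complex.norm_real, Real.norm_of_nonneg (poissonKernel_circleMap_nonneg hz' θ)]
    exact poissonKernel_circleMap_le hz' θ
  have hin : ∀ u : Lp ℂ 2 angleMeasure, ∀ u' : ℝ → ℂ, u =ᵐ[angleMeasure] u' →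
      inner ℂ (hPm.toLp _) u =
        ∫ θ, poissonKernel 0 z (circleMap 0 1 θ) • u' θ ∂angleMeasure := by
    intro u u' hu
    rw [L2.inner_def]
    refine integral_congr_ae ?_
    filter_upwards [hPm.coeFn_toLp, hu] with θ h1 h2
    rw [h1, h2]
    simp [mul_comm]
  -- The functionals are `inner (v r) ·`, so conjugation is needed to turn their limit into weak
  -- convergence of `v r` to `f`, here tested against the Poisson kernel.
  have h1 : Tendsto (fun r => inner ℂ (hPm.toLp _) (v r)) 𝒰 (𝓝 (inner ℂ (hPm.toLp _) f)) := by
    have h2 := (Complex.continuous_conj.tendsto _).comp (hL (hPm.toLp _))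
    rw [hfL] at h2
    simpa [Function.comp_def, inner_conj_symm] using h2
  rw [← hin f f EventuallyEq.rfl]
  refine tendsto_nhds_unique h1 (((tendsto_dilation hg hz').mono_left h𝒰).congr' ?_)
  filter_upwards [h𝒰 eventually_nhdsLT_one] with r hr
  rw [hin _ _ (hv r hr).2, integral_poissonKernel_smul_dilation hg hr.1.le hr.2 hz']

/-! ### Fatou's theorem on nontangential limits -/

/-- Only the first dyadic ball containing `x` is needed: for `k = 0` the kernel is at most `1 / s`,
and for `k ≥ 1` the bound `|x - x₀| > 2 ^ (k - 1) * s` makes it at most `4 * 4 ^ (-k) / s`. -/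
theorem ofReal_div_le_tsum_indicator {s : ℝ} (hs : 0 < s) (x₀ x : ℝ) :
    ENNReal.ofReal (s / (s ^ 2 + (x - x₀) ^ 2)) ≤
      ∑' k : ℕ, (closedBall x₀ (2 ^ k * s)).indicator
        (fun _ => ENNReal.ofReal (4 * (1 / 4) ^ k / s)) x := by
  have hex : ∃ k : ℕ, |x - x₀| ≤ 2 ^ k * s := by
    obtain ⟨k, hk⟩ := pow_unbounded_of_one_lt (|x - x₀| / s) (one_lt_two)
    exact ⟨k, (div_le_iff₀ hs).1 hk.le⟩
  classical
  refine le_trans ?_ (ENNReal.le_tsum (Nat.find hex))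
  have hmem : x ∈ closedBall x₀ (2 ^ (Nat.find hex) * s) := by
    rw [mem_closedBall, Real.dist_eq]
    exact Nat.find_spec hex
  rw [Set.indicator_of_mem hmem]
  refine ENNReal.ofReal_le_ofReal ?_
  rcases Nat.eq_zero_or_pos (Nat.find hex) with h0 | h0
  · rw [h0, div_le_div_iff₀ (by positivity) hs]
    nlinarith [sq_nonneg (x - x₀)]
  · have hlt := Nat.find_min hex (Nat.pred_lt h0.ne')
    obtain ⟨j, hj⟩ := Nat.exists_eq_succ_of_ne_zero h0.ne'
    rw [hj] at hlt ⊢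
    simp only [Nat.succ_eq_add_one, Nat.pred_eq_sub_one, Nat.add_sub_cancel, not_le] at hlt ⊢
    have h2 : (2 ^ j * s) ^ 2 ≤ (x - x₀) ^ 2 := by
      rw [← sq_abs (x - x₀)]
      gcongr
    have h4 : ((1 : ℝ) / 4) ^ (j + 1) * 4 * (2 ^ j) ^ 2 = 1 := by
      have h44 : ((1 : ℝ) / 4) ^ j * 4 ^ j = 1 := by
        rw [← mul_pow]
        norm_num
      rw [pow_succ, ← pow_mul, mul_comm j 2, pow_mul]
      norm_num
      linarith
    rw [div_le_div_iff₀ (by positivity) hs]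
    have h5 : (0 : ℝ) < (1 / 4) ^ (j + 1) := by positivity
    have h6 : s * s = 4 * (1 / 4) ^ (j + 1) * (2 ^ j * s) ^ 2 := by
      linear_combination -(s * s) * h4
    rw [h6]
    gcongr
    nlinarith [sq_nonneg s]

/-- The dyadic ball of radius `2 ^ k * s`, cut off at `ρ`, has mass at most `δ * 2 ^ k * s` and
weight `4 * 4 ^ (-k) / s`. The products `4 * 2 ^ (-k) * δ` sum to `8 * δ`. -/
theorem lintegral_closedBall_kernel_le {Ψ : ℝ → ℝ≥0∞} (hΨ : AEMeasurable Ψ) {x₀ ρ : ℝ} {δ : ℝ≥0∞}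
    (hδ : ∀ t, 0 < t → t ≤ ρ → ∫⁻ x in closedBall x₀ t, Ψ x ≤ δ * ENNReal.ofReal t)
    (hρ : 0 < ρ) {s : ℝ} (hs : 0 < s) :
    ∫⁻ x in closedBall x₀ ρ, ENNReal.ofReal (s / (s ^ 2 + (x - x₀) ^ 2)) * Ψ x ≤ 8 * δ := by
  calc ∫⁻ x in closedBall x₀ ρ, ENNReal.ofReal (s / (s ^ 2 + (x - x₀) ^ 2)) * Ψ x
      ≤ ∫⁻ x in closedBall x₀ ρ, ∑' k : ℕ, (closedBall x₀ (2 ^ k * s)).indicator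
          (fun x => ENNReal.ofReal (4 * (1 / 4) ^ k / s) * Ψ x) x := by
        refine lintegral_mono fun x => ?_
        refine (mul_le_mul_left (ofReal_div_le_tsum_indicator hs x₀ x) _).trans_eq ?_
        rw [← ENNReal.tsum_mul_right]
        refine tsum_congr fun k => ?_
        by_cases hx : x ∈ closedBall x₀ (2 ^ k * s) <;> simp [hx]
    _ = ∑' k : ℕ, ∫⁻ x in closedBall x₀ ρ, (closedBall x₀ (2 ^ k * s)).indicator
          (fun x => ENNReal.ofReal (4 * (1 / 4) ^ k / s) * Ψ x) x := by
        refine lintegral_tsum fun k => ?_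
        exact ((hΨ.const_mul _).restrict).indicator measurableSet_closedBall
    _ ≤ ∑' k : ℕ, ENNReal.ofReal (4 * (1 / 2) ^ k) * δ := by
        refine ENNReal.tsum_le_tsum fun k => ?_
        rw [lintegral_indicator measurableSet_closedBall,
          Measure.restrict_restrict measurableSet_closedBall,
          lintegral_const_mul'' _ hΨ.restrict]
        have hsub : closedBall x₀ (2 ^ k * s) ∩ closedBall x₀ ρ ⊆
            closedBall x₀ (min (2 ^ k * s) ρ) := by
          intro x hx
          simpa using hx
        have h1 : ∫⁻ x in closedBall x₀ (2 ^ k * s) ∩ closedBall x₀ ρ, Ψ x ≤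
            δ * ENNReal.ofReal (2 ^ k * s) := by
          refine (lintegral_mono_set hsub).trans ((hδ _ (by positivity) (min_le_right _ _)).trans ?_)
          gcongr
          exact min_le_left _ _
        refine (mul_le_mul_right h1 _).trans_eq ?_
        rw [mul_comm δ, ← mul_assoc, ← ENNReal.ofReal_mul (by positivity)]
        congr 2
        have : ((1 : ℝ) / 4) ^ k * 2 ^ k = (1 / 2) ^ k := by
          rw [← mul_pow]
          norm_num
        rw [← this]
        field_simp
    _ = 8 * δ := by
        rw [ENNReal.tsum_mul_right, ← ENNReal.ofReal_tsum_of_nonneg (fun _ => by positivity)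
          (summable_geometric_two.mul_left 4), tsum_mul_left, tsum_geometric_two]
        norm_num

/-- Within `ρ` of `x₀` the small averages of `Ψ` control the integral; farther away the kernel is at
most `s / ρ ^ 2`, which tends to 0. -/
theorem tendsto_lintegral_kernel {Ψ : ℝ → ℝ≥0∞} (hΨ : AEMeasurable Ψ) {x₀ : ℝ} {S : Set ℝ}
    (hS : ∫⁻ x in S, Ψ x ≠ ∞) (hSm : MeasurableSet S)
    (h : Tendsto (fun t => (∫⁻ x in closedBall x₀ t, Ψ x) / volume (closedBall x₀ t))
      (𝓝[>] 0) (𝓝 0)) :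
    Tendsto (fun s => ∫⁻ x in S, ENNReal.ofReal (s / (s ^ 2 + (x - x₀) ^ 2)) * Ψ x)
      (𝓝[>] 0) (𝓝 0) := by
  rw [ENNReal.tendsto_nhds_zero] at h ⊢
  intro η hη
  -- `16 = 8 * 2`: 8 from the dyadic sum, 2 because a ball of radius `t` has length `2 * t`.
  obtain ⟨δ, hδ0, hδ⟩ : ∃ δ : ℝ≥0∞, 0 < δ ∧ 16 * δ ≤ η / 2 := by
    refine ⟨η / 2 / 16, ENNReal.div_pos (ENNReal.half_pos hη.ne').ne' (by norm_num), ?_⟩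
    exact ENNReal.mul_div_le
  have h1 := h δ hδ0
  rw [eventually_nhdsWithin_iff, Metric.eventually_nhds_iff] at h1
  obtain ⟨ρ', hρ', h1⟩ := h1
  set ρ := ρ' / 2 with hρ
  have hρ0 : 0 < ρ := by positivity
  have h2 : ∀ t, 0 < t → t ≤ ρ →
      ∫⁻ x in closedBall x₀ t, Ψ x ≤ 2 * δ * ENNReal.ofReal t := by
    intro t ht htρ
    have h3 := h1 (y := t) (by rw [Real.dist_eq, sub_zero, abs_of_pos ht]; linarith) ht
    rw [ENNReal.div_le_iff (by simpa using ht) (by simp [ENNReal.mul_eq_top]),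
      Real.volume_closedBall,
      ENNReal.ofReal_mul (by norm_num)] at h3
    refine h3.trans_eq ?_
    rw [ENNReal.ofReal_ofNat]
    ring
  have h4 : Tendsto (fun s : ℝ => ENNReal.ofReal (s / ρ ^ 2) * ∫⁻ x in S, Ψ x) (𝓝[>] 0) (𝓝 0) := by
    have : Tendsto (fun s : ℝ => ENNReal.ofReal (s / ρ ^ 2)) (𝓝[>] 0) (𝓝 0) := by
      have h5 : Tendsto (fun s : ℝ => s / ρ ^ 2) (𝓝[>] 0) (𝓝 0) := by
        have : Continuous fun s : ℝ => s / ρ ^ 2 := by fun_prop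
        simpa using (this.tendsto 0).mono_left nhdsWithin_le_nhds
      simpa using ENNReal.tendsto_ofReal h5
    simpa using ENNReal.Tendsto.mul_const this (Or.inr hS)
  rw [ENNReal.tendsto_nhds_zero] at h4
  filter_upwards [h4 (η / 2) (ENNReal.half_pos hη.ne'), self_mem_nhdsWithin] with s h6 hs
  have hs : 0 < s := hs
  rw [← lintegral_inter_add_sdiff _ S (measurableSet_closedBall (x := x₀) (ε := ρ)),
    ← ENNReal.add_halves η]
  refine add_le_add ?_ ?_
  · refine (lintegral_mono_set Set.inter_subset_right).trans
      ((lintegral_closedBall_kernel_le hΨ h2 hρ0 hs).trans ?_)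
    rw [← mul_assoc]
    norm_num
    exact hδ
  · refine le_trans ?_ h6
    rw [← lintegral_const_mul'' _ hΨ.restrict]
    refine (setLIntegral_mono_ae' (hSm.diff measurableSet_closedBall) ?_).trans
      (lintegral_mono_set Set.sdiff_subset)
    refine Eventually.of_forall fun x hx => ?_
    gcongr
    have : ρ < |x - x₀| := by
      have := hx.2
      rwa [mem_closedBall, not_le, Real.dist_eq] at this
    have h7 : ρ ^ 2 ≤ (x - x₀) ^ 2 := by
      rw [← sq_abs (x - x₀)]
      gcongr
    nlinarith [sq_nonneg s]

/-- The chord is `2 sin (|θ - θ₀| / 2)`. As the angles 0 and `2π` give the same point, the constant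
must depend on the distance `d` from `θ₀` to the endpoints. -/
theorem exists_mul_abs_sub_le_norm_circleMap_sub {θ₀ : ℝ} (h₀ : θ₀ ∈ Set.Ioo 0 (2 * Real.pi)) :
    ∃ c, 0 < c ∧ ∀ θ ∈ Set.Ioc 0 (2 * Real.pi),
      c * |θ - θ₀| ≤ ‖circleMap 0 1 θ - circleMap 0 1 θ₀‖ := by
  have hπ := Real.pi_pos
  set d := min θ₀ (2 * Real.pi - θ₀) with hd
  have hd0 : 0 < d := lt_min h₀.1 (by linarith [h₀.2])
  have hd1 : d ≤ Real.pi := by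
    rcases le_total θ₀ Real.pi with h | h
    · exact (min_le_left _ _).trans h
    · exact (min_le_right _ _).trans (by linarith)
  refine ⟨d / Real.pi ^ 2, by positivity, fun θ hθ => ?_⟩
  have habs : |θ - θ₀| ≤ 2 * Real.pi - d := by
    rw [abs_le]
    constructor
    · linarith [min_le_right θ₀ (2 * Real.pi - θ₀), hθ.1]
    · linarith [min_le_left θ₀ (2 * Real.pi - θ₀), hθ.2]
  have hnorm : ‖circleMap 0 1 θ - circleMap 0 1 θ₀‖ = 2 * Real.sin (|θ - θ₀| / 2) := by
    have h1 : circleMap 0 1 θ - circleMap 0 1 θ₀ =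
        circleMap 0 1 θ₀ * (Complex.exp (Complex.I * ((θ - θ₀ : ℝ) : ℂ)) - 1) := by
      simp only [circleMap_zero, Complex.ofReal_one, one_mul, mul_sub, mul_one, ← Complex.exp_add]
      congr 2
      push_cast
      ring
    rw [h1, norm_mul, Complex.norm_exp_I_mul_ofReal_sub_one, norm_circleMap_zero, abs_one, one_mul,
      norm_mul, Real.norm_of_nonneg zero_le_two, Real.norm_eq_abs]
    congr 1
    rw [← abs_of_pos (zero_lt_two' ℝ), ← abs_div, abs_of_pos (zero_lt_two' ℝ),
      ← Real.abs_sin_eq_sin_abs_of_abs_le_pi]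
    rw [abs_div, abs_of_pos (zero_lt_two' ℝ)]
    linarith
  rw [hnorm]
  set x := |θ - θ₀| / 2 with hx
  have hx0 : 0 ≤ x := by positivity
  have hxd : |θ - θ₀| = 2 * x := by rw [hx]; ring
  rw [hxd, div_mul_eq_mul_div, div_le_iff₀ (by positivity)]
  -- Here `x ≤ π - d / 2`. Jordan's inequality is applied to `x` on the first half and to `π - x ≥ d
  -- / 2` on the second.
  rcases le_total x (Real.pi / 2) with h | h
  · have h2 := Real.mul_le_sin hx0 h
    calc d * (2 * x) ≤ Real.pi * (2 * x) := by gcongr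
      _ = (2 / Real.pi * x) * Real.pi ^ 2 := by field_simp
      _ ≤ Real.sin x * Real.pi ^ 2 := by gcongr
      _ ≤ 2 * Real.sin x * Real.pi ^ 2 := by
        have : 0 ≤ Real.sin x := le_trans (by positivity) h2
        nlinarith [sq_nonneg Real.pi, mul_nonneg this (sq_nonneg Real.pi)]
  · have h2 := Real.mul_le_sin (x := Real.pi - x) (by linarith) (by linarith)
    rw [Real.sin_pi_sub] at h2
    calc d * (2 * x) ≤ d * (2 * Real.pi) := by gcongr; linarith
      _ = 2 * (2 / Real.pi * (d / 2)) * Real.pi ^ 2 := by field_simp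
      _ ≤ 2 * (2 / Real.pi * (Real.pi - x)) * Real.pi ^ 2 := by gcongr; linarith
      _ ≤ 2 * Real.sin x * Real.pi ^ 2 := by gcongr

/-- In a Stolz angle at `ζ₀`, `|ζ - z|` bounds `1 - |z|`, and `1 + K` times it bounds `|ζ - ζ₀|`.
The kernel can thus be recentred at `θ₀`. -/
theorem poissonKernel_circleMap_le_kernel {θ₀ : ℝ} (h₀ : θ₀ ∈ Set.Ioo 0 (2 * Real.pi)) {K : ℝ}
    (hK : 0 ≤ K) : ∃ C, 0 ≤ C ∧ ∀ z : ℂ, ‖z‖ < 1 → ‖z - circleMap 0 1 θ₀‖ ≤ K * (1 - ‖z‖) →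
      ∀ θ ∈ Set.Ioc 0 (2 * Real.pi), poissonKernel 0 z (circleMap 0 1 θ) ≤
        C * ((1 - ‖z‖) / ((1 - ‖z‖) ^ 2 + (θ - θ₀) ^ 2)) := by
  obtain ⟨c, hc, h⟩ := exists_mul_abs_sub_le_norm_circleMap_sub h₀
  set B := 1 + ((1 + K) / c) ^ 2 with hB
  refine ⟨2 * B, by positivity, fun z hz hzK θ hθ => ?_⟩
  set s := 1 - ‖z‖ with hs
  have hs0 : 0 < s := by linarith
  set D := ‖circleMap 0 1 θ - z‖ with hD
  have h1 : s ≤ D := by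
    have := norm_sub_norm_le (circleMap 0 1 θ) z
    rw [norm_circleMap_zero, abs_one] at this
    exact this
  have h2 : c * |θ - θ₀| ≤ (1 + K) * D := by
    refine (h θ hθ).trans ?_
    have : ‖circleMap 0 1 θ - circleMap 0 1 θ₀‖ ≤ D + ‖z - circleMap 0 1 θ₀‖ :=
      norm_sub_le_norm_sub_add_norm_sub _ _ _
    nlinarith
  have h3 : |θ - θ₀| ≤ (1 + K) / c * D := by
    rw [div_mul_eq_mul_div, le_div_iff₀ hc]
    linarith
  have h4 : s ^ 2 + (θ - θ₀) ^ 2 ≤ B * D ^ 2 := by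
    have h5 : |θ - θ₀| ^ 2 ≤ ((1 + K) / c * D) ^ 2 := by gcongr
    have h6 : s ^ 2 ≤ D ^ 2 := by gcongr
    rw [sq_abs, mul_pow] at h5
    rw [hB, add_mul, one_mul]
    linarith
  have hD0 : 0 < D := hs0.trans_le h1
  simp only [poissonKernel_def, sub_zero, norm_circleMap_zero, abs_one]
  rw [← mul_div_assoc, div_le_div_iff₀ (by positivity) (by positivity)]
  have h7 : 1 ^ 2 - ‖z‖ ^ 2 ≤ 2 * s := by nlinarith [norm_nonneg z]
  calc (1 ^ 2 - ‖z‖ ^ 2) * (s ^ 2 + (θ - θ₀) ^ 2) ≤ (2 * s) * (B * D ^ 2) := by gcongr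
    _ = 2 * B * s * D ^ 2 := by ring

/-- Fatou's theorem: Poisson integrals converge nontangentially almost everywhere. -/
theorem ae_tendsto_integral_poissonKernel {V : Type*} [NormedAddCommGroup V] [NormedSpace ℝ V]
    [CompleteSpace V] {f : ℝ → V} (hf : Integrable f angleMeasure) :
    ∀ᵐ θ₀ ∂angleMeasure, ∀ {ι : Type} (l : Filter ι) (z : ι → ℂ) (K : ℝ), 0 ≤ K →
      Tendsto z l (𝓝 (circleMap 0 1 θ₀)) → (∀ᶠ i in l, ‖z i‖ < 1) →
      (∀ᶠ i in l, ‖z i - circleMap 0 1 θ₀‖ ≤ K * (1 - ‖z i‖)) →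
      Tendsto (fun i => ∫ θ, poissonKernel 0 (z i) (circleMap 0 1 θ) • f θ ∂angleMeasure) l
        (𝓝 (f θ₀)) := by
  have hπ := Real.pi_pos
  set S := Set.Ioc 0 (2 * Real.pi) with hS
  have hfS : IntegrableOn f S := by
    rw [angleMeasure_eq_smul_restrict, integrable_smul_measure (by simp; positivity) (by simp)] at hf
    exact hf
  set F : ℝ → V := S.indicator f with hF
  have hFi : Integrable F := hfS.integrable_indicator measurableSet_Ioc
  have hL := (IsUnifLocDoublingMeasure.vitaliFamily (volume : Measure ℝ)
    1).ae_tendsto_lintegral_enorm_sub_div hFi.locallyIntegrable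
  refine Measure.ae_smul_measure (μ := volume.restrict S) ?_ _
  rw [ae_restrict_iff' measurableSet_Ioc]
  have hne : ∀ᵐ θ₀ : ℝ, θ₀ ≠ 2 * Real.pi := by
    rw [ae_iff]
    simp
  filter_upwards [hL, hne] with θ₀ hθ₀ hne hmem ι l z K hK hz hz1 hzK
  have hIoo : θ₀ ∈ Set.Ioo 0 (2 * Real.pi) := ⟨hmem.1, lt_of_le_of_ne hmem.2 hne⟩
  set Ψ : ℝ → ℝ≥0∞ := fun x => ‖F x - F θ₀‖ₑ with hΨ
  have hΨm : AEMeasurable Ψ := (hFi.aestronglyMeasurable.sub aestronglyMeasurable_const).enorm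
  have hballs : Tendsto (fun t => (∫⁻ x in closedBall θ₀ t, Ψ x) / volume (closedBall θ₀ t))
      (𝓝[>] 0) (𝓝 0) := by
    refine hθ₀.comp (IsUnifLocDoublingMeasure.tendsto_closedBall_filterAt volume
      (K := 1) (fun _ => θ₀) id tendsto_id ?_)
    filter_upwards [self_mem_nhdsWithin] with t ht
    have ht : 0 < t := ht
    simp [ht.le]
  have hfin : ∫⁻ x in S, Ψ x ≠ ∞ := by
    have : IntegrableOn (fun x => F x - F θ₀) S :=
      hFi.integrableOn.sub (integrableOn_const (by simp [hS, ENNReal.mul_eq_top]))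
    exact this.2.ne
  have hker := tendsto_lintegral_kernel hΨm hfin measurableSet_Ioc hballs
  obtain ⟨C, hC, hPC⟩ := poissonKernel_circleMap_le_kernel hIoo hK
  have hs : Tendsto (fun i => 1 - ‖z i‖) l (𝓝[>] 0) := by
    refine tendsto_nhdsWithin_iff.2 ⟨?_, ?_⟩
    · have := (hz.norm).const_sub 1
      simpa using this
    · filter_upwards [hz1] with i hi
      simpa using hi
  have hker' := hker.comp hs
  rw [tendsto_iff_edist_tendsto_0]
  have hup : Tendsto (fun i => ENNReal.ofReal (2 * Real.pi)⁻¹ * (ENNReal.ofReal C *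
      ∫⁻ x in S, ENNReal.ofReal ((1 - ‖z i‖) / ((1 - ‖z i‖) ^ 2 + (x - θ₀) ^ 2)) * Ψ x)) l
      (𝓝 0) := by
    have := ENNReal.Tendsto.const_mul (a := ENNReal.ofReal (2 * Real.pi)⁻¹)
      (ENNReal.Tendsto.const_mul (a := ENNReal.ofReal C) hker' (Or.inr ENNReal.ofReal_ne_top))
      (Or.inr ENNReal.ofReal_ne_top)
    simpa using this
  refine tendsto_of_tendsto_of_tendsto_of_le_of_le' tendsto_const_nhds hup
    (Eventually.of_forall fun _ => zero_le) ?_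
  filter_upwards [hz1, hzK] with i hi hiK
  -- The Poisson kernel has total mass 1, so the error is the Poisson integral of `f - f θ₀`.
  have hconst : ∫ θ, poissonKernel 0 (z i) (circleMap 0 1 θ) • f θ₀ ∂angleMeasure = f θ₀ := by
    rw [integral_smul_const, integral_poissonKernel hi, one_smul]
  rw [edist_eq_enorm_sub]
  rw [← hconst]
  rw [← integral_sub (integrable_poissonKernel_smul hf hi)
    (integrable_poissonKernel_smul (integrable_const _) hi)]
  refine (enorm_integral_le_lintegral_enorm _).trans ?_
  rw [angleMeasure_eq_smul_restrict, lintegral_smul_measure, smul_eq_mul, ← hS]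
  refine mul_le_mul_right ?_ _
  rw [← lintegral_const_mul' _ _ ENNReal.ofReal_ne_top]
  refine setLIntegral_mono_ae' measurableSet_Ioc (Eventually.of_forall fun θ hθ => ?_)
  have hFθ : Ψ θ = ‖f θ - f θ₀‖ₑ := by
    simp only [hΨ, hF]
    rw [Set.indicator_of_mem hθ, Set.indicator_of_mem hmem]
  rw [← smul_sub, enorm_smul, ← hFθ, ← mul_assoc, ← ENNReal.ofReal_mul hC,
    Real.enorm_of_nonneg (poissonKernel_circleMap_nonneg hi θ)]
  exact mul_le_mul_left (ENNReal.ofReal_le_ofReal (hPC _ hi hiK θ hθ)) _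

/-! ### The set of nontangential limit points -/

theorem exists_seq_of_mem_nontangentialLimitPoints {E : Set ℂ} (hE : E ⊆ ball (0 : ℂ) 1) {ζ : ℂ}
    (hζ : ζ ∈ nontangentialLimitPoints E) :
    ∃ (z : ℕ → ℂ) (K : ℝ), 0 ≤ K ∧ (∀ n, z n ∈ E) ∧ Tendsto z atTop (𝓝 ζ) ∧
      ∀ᶠ n in atTop, ‖z n - ζ‖ ≤ K * (1 - ‖z n‖) := by
  obtain ⟨-, z, hz, hlim, hO⟩ := hζ
  obtain ⟨K, hK, hb⟩ := hO.exists_nonneg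
  refine ⟨z, K, hK, hz, hlim, ?_⟩
  filter_upwards [hb.bound] with n hn
  have : ‖z n‖ < 1 := by simpa using hE (hz n)
  rwa [Real.norm_of_nonneg (by linarith)] at hn

/-- Integer apertures `K` and accuracies `1 / (n + 1)` leave only countable operations. The strict
inequalities make the remaining union over `z ∈ E` open, even for uncountable `E`. -/
theorem measurableSet_nontangentialLimitPoints {E : Set ℂ} (hE : E ⊆ ball (0 : ℂ) 1) :
    MeasurableSet (nontangentialLimitPoints E) := by
  have heq : nontangentialLimitPoints E = sphere (0 : ℂ) 1 ∩ ⋃ K : ℕ, ⋂ n : ℕ, ⋃ z ∈ E,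
      {ζ | ‖z - ζ‖ < 1 / ((n : ℝ) + 1) ∧ ‖z - ζ‖ < K * (1 - ‖z‖)} := by
    ext ζ
    simp only [Set.mem_inter_iff, Set.mem_iUnion, Set.mem_iInter, Set.mem_ofPred_eq, exists_prop]
    constructor
    · intro hζ
      obtain ⟨z, K, -, hz, hlim, hb⟩ := exists_seq_of_mem_nontangentialLimitPoints hE hζ
      obtain ⟨k, hk⟩ := exists_nat_gt K
      refine ⟨hζ.1, k, fun n => ?_⟩
      have h1 : ∀ᶠ i in atTop, ‖z i - ζ‖ < 1 / ((n : ℝ) + 1) := by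
        have := hlim.eventually (ball_mem_nhds ζ (Nat.one_div_pos_of_nat (n := n)))
        simpa [dist_eq_norm] using this
      obtain ⟨i, hi1, hi2⟩ := (h1.and hb).exists
      have : ‖z i‖ < 1 := by simpa using hE (hz i)
      exact ⟨z i, hz i, hi1, hi2.trans_lt (mul_lt_mul_of_pos_right hk (by linarith))⟩
    · rintro ⟨hs, k, h⟩
      choose z hz h1 h2 using h
      refine ⟨hs, z, hz, ?_, ?_⟩
      · rw [tendsto_iff_norm_sub_tendsto_zero]
        exact squeeze_zero (fun _ => norm_nonneg _) (fun n => (h1 n).le)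
          tendsto_one_div_add_atTop_nhds_zero_nat
      · refine Asymptotics.IsBigO.of_bound k (Eventually.of_forall fun n => ?_)
        have : ‖z n‖ < 1 := by simpa using hE (hz n)
        rw [Real.norm_of_nonneg (by linarith)]
        exact (h2 n).le
  rw [heq]
  refine isClosed_sphere.measurableSet.inter ?_
  refine MeasurableSet.iUnion fun k => MeasurableSet.iInter fun n => IsOpen.measurableSet ?_
  refine isOpen_biUnion fun z _ => ?_
  have hc : Continuous fun ζ : ℂ => ‖z - ζ‖ := by fun_prop
  exact (isOpen_lt hc continuous_const).inter (isOpen_lt hc continuous_const)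

/-! ### Harmonic measure and radial limits -/

section HarmonicMeasure

variable {S : Set ℂ}

theorem integrable_indicator_circleMap (hS : MeasurableSet S) :
    Integrable (fun θ => S.indicator (fun _ => (1 : ℝ)) (circleMap 0 1 θ)) angleMeasure := by
  refine Integrable.of_bound (C := 1) ?_ (Eventually.of_forall fun θ => ?_)
  · exact ((measurable_const.indicator hS).comp (by fun_prop)).aestronglyMeasurable
  · by_cases h : circleMap 0 1 θ ∈ S <;> simp [h]

theorem discHarmonicMeasure_eq_integral (z : ℂ) :
    discHarmonicMeasure S z = ∫ θ, poissonKernel 0 z (circleMap 0 1 θ) •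
      S.indicator (fun _ => (1 : ℝ)) (circleMap 0 1 θ) ∂angleMeasure := by
  rw [discHarmonicMeasure, circleAverage_eq_integral_angleMeasure]
  rfl

theorem discHarmonicMeasure_nonneg {z : ℂ} (hz : ‖z‖ < 1) : 0 ≤ discHarmonicMeasure S z := by
  rw [discHarmonicMeasure_eq_integral]
  refine integral_nonneg fun θ => ?_
  exact mul_nonneg (poissonKernel_circleMap_nonneg hz θ)
    (Set.indicator_nonneg (fun _ _ => zero_le_one) _)

theorem discHarmonicMeasure_le_one (hS : MeasurableSet S) {z : ℂ} (hz : ‖z‖ < 1) :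
    discHarmonicMeasure S z ≤ 1 := by
  rw [discHarmonicMeasure_eq_integral]
  have hi := integrable_poissonKernel_smul (integrable_indicator_circleMap hS) hz
  have hP := integrable_angleMeasure_of_continuous (continuous_poissonKernel_circleMap hz)
  refine (integral_mono hi hP fun θ => ?_).trans_eq (integral_poissonKernel hz)
  have h1 : S.indicator (fun _ => (1 : ℝ)) (circleMap 0 1 θ) ≤ 1 :=
    Set.indicator_apply_le' (fun _ => le_rfl) fun _ => zero_le_one
  exact mul_le_of_le_one_right (poissonKernel_circleMap_nonneg hz θ) h1

/-- Harmonic measure is the real part of a holomorphic function. -/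
theorem exists_re_eq_discHarmonicMeasure (hS : MeasurableSet S) :
    ∃ W : ℂ → ℂ, DifferentiableOn ℂ W (ball 0 1) ∧
      ∀ z ∈ ball (0 : ℂ) 1, (W z).re = discHarmonicMeasure S z := by
  have h1 : CircleIntegrable (S.indicator (fun _ => (1 : ℝ))) 0 1 :=
    circleIntegrable_iff_integrable_angleMeasure.2 (integrable_indicator_circleMap hS)
  have h2 : CircleIntegrable (fun ζ => ((S.indicator (fun _ => (1 : ℝ)) ζ : ℝ) : ℂ)) 0 1 :=
    circleIntegrable_iff_integrable_angleMeasure.2 (integrable_indicator_circleMap hS).ofReal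
  refine ⟨_, differentiableOn_circleAverage_herglotzRieszKernel_smul h2, fun z hz => ?_⟩
  rw [re_circleAverage_herglotzRieszKernel_smul h1 hz, ← poissonKernel_eq_re_herglotzRieszKernel]
  rfl

theorem tendsto_circleMap_radial (θ : ℝ) :
    Tendsto (fun r : ℝ => circleMap 0 r θ) (𝓝[<] 1) (𝓝 (circleMap 0 1 θ)) := by
  have : Continuous fun r : ℝ => circleMap 0 r θ := by
    simp only [circleMap_zero]
    fun_prop
  exact (this.tendsto 1).mono_left nhdsWithin_le_nhds

theorem ae_tendsto_radial {V : Type*} [NormedAddCommGroup V] [NormedSpace ℝ V] [CompleteSpace V]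
    {f : ℝ → V} (hf : Integrable f angleMeasure) {u : ℂ → V} (hu : ∀ z ∈ ball (0 : ℂ) 1,
      ∫ θ, poissonKernel 0 z (circleMap 0 1 θ) • f θ ∂angleMeasure = u z) :
    ∀ᵐ θ ∂angleMeasure, Tendsto (fun r => u (circleMap 0 r θ)) (𝓝[<] (1 : ℝ)) (𝓝 (f θ)) := by
  filter_upwards [ae_tendsto_integral_poissonKernel hf] with θ hθ
  have hn : ∀ᶠ r : ℝ in 𝓝[<] (1 : ℝ), ‖circleMap 0 r θ‖ < 1 := by
    filter_upwards [eventually_nhdsLT_one] with r hr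
    rw [norm_circleMap_zero, abs_of_pos hr.1]
    exact hr.2
  refine (hθ (𝓝[<] (1 : ℝ)) (fun r => circleMap 0 r θ) 1 zero_le_one (tendsto_circleMap_radial θ)
    hn ?_).congr' ?_
  · filter_upwards [eventually_nhdsLT_one] with r hr
    have h1 : circleMap 0 r θ - circleMap 0 1 θ = ((r - 1 : ℝ) : ℂ) * circleMap 0 1 θ := by
      rw [← mul_circleMap_one r]
      push_cast
      ring
    rw [h1, norm_mul, norm_circleMap_zero, norm_circleMap_zero, abs_one, mul_one, one_mul,
      Complex.norm_real, Real.norm_eq_abs, abs_of_pos hr.1, abs_of_neg (by linarith [hr.2])]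
    linarith
  · filter_upwards [hn] with r hr
    exact hu _ (by simpa using hr)

end HarmonicMeasure

/-! ### The two constants estimate -/

theorem ae_norm_le_of_norm_le {E : Set ℂ} (hE : E ⊆ ball (0 : ℂ) 1) {g : ℂ → ℂ} {ε : ℝ}
    (hgE : ∀ ζ ∈ E, ‖g ζ‖ ≤ ε) {f : ℝ → ℂ} (hf : Integrable f angleMeasure)
    (hfg : ∀ z ∈ ball (0 : ℂ) 1,
      ∫ θ, poissonKernel 0 z (circleMap 0 1 θ) • f θ ∂angleMeasure = g z) :
    ∀ᵐ θ ∂angleMeasure, circleMap 0 1 θ ∈ nontangentialLimitPoints E → ‖f θ‖ ≤ ε := by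
  filter_upwards [ae_tendsto_integral_poissonKernel hf] with θ hθ hmem
  obtain ⟨z, K, hK, hz, hlim, hb⟩ := exists_seq_of_mem_nontangentialLimitPoints hE hmem
  have h1 := hθ atTop z K hK hlim
    (Eventually.of_forall fun n => by simpa using hE (hz n)) hb
  refine le_of_tendsto h1.norm (Eventually.of_forall fun n => ?_)
  rw [hfg _ (hE (hz n))]
  exact hgE _ (hz n)

theorem circleMap_mem_ball {r : ℝ} (hr : 0 < r ∧ r < 1) (θ : ℝ) :
    circleMap 0 r θ ∈ ball (0 : ℂ) 1 := by
  simpa [abs_of_pos hr.1] using hr.2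

/-- The two constants estimate for bounded functions in the unit ball of `H^p`. -/
theorem norm_le_rpow_discHarmonicMeasure_of_bounded {E : Set ℂ} (hE : E ⊆ ball (0 : ℂ) 1)
    {g : ℂ → ℂ} (hg : DifferentiableOn ℂ g (ball 0 1)) {M : ℝ}
    (hM : ∀ z ∈ ball (0 : ℂ) 1, ‖g z‖ ≤ M) {p : ℝ} (hp : 1 ≤ p)
    (hmean : ∀ C : ℝ, 1 < C →
      ∀ᶠ r in 𝓝[<] (1 : ℝ), ∫ θ, ‖g (circleMap 0 r θ)‖ ^ p ∂angleMeasure ≤ C)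
    {ε : ℝ} (hε : 0 < ε) (hgE : ∀ ζ ∈ E, ‖g ζ‖ ≤ ε) {z : ℂ} (hz : ‖z‖ < 1) :
    ‖g z‖ ≤ (2 / (1 - ‖z‖ ^ 2)) ^ (1 / p) *
      ε ^ discHarmonicMeasure (nontangentialLimitPoints E) z := by
  have hp0 : 0 < p := by linarith
  set S := nontangentialLimitPoints E with hS
  have hSm : MeasurableSet S := measurableSet_nontangentialLimitPoints hE
  set ω := discHarmonicMeasure S with hω
  have hM0 : 0 ≤ M := (norm_nonneg _).trans (hM 0 (by simp))
  obtain ⟨W, hW, hWω⟩ := exists_re_eq_discHarmonicMeasure hSm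
  obtain ⟨f, hf, hfg⟩ := exists_eq_integral_poissonKernel hg hM
  set h : ℂ → ℂ := fun w => g w * Complex.exp (-(Real.log ε : ℂ) * W w) with hh
  have hhd : DifferentiableOn ℂ h (ball 0 1) := hg.mul ((hW.const_mul _).cexp)
  have hhn : ∀ w ∈ ball (0 : ℂ) 1, ‖h w‖ = ‖g w‖ * ε ^ (-ω w) := by
    intro w hw
    rw [hh, norm_mul, Complex.norm_exp, Real.rpow_def_of_pos hε, ← Complex.ofReal_neg,
      Complex.re_ofReal_mul, hWω w hw]
    congr 2
    ring
  -- As `0 ≤ ω ≤ 1`, this bounds `ε ^ (-ω)` for either sign of `log ε`.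
  set B := Real.exp |Real.log ε| with hB
  have hεB : ∀ w ∈ ball (0 : ℂ) 1, ε ^ (-ω w) ≤ B := by
    intro w hw
    have hw' : ‖w‖ < 1 := by simpa using hw
    have h0 : 0 ≤ ω w := discHarmonicMeasure_nonneg hw'
    have h1 : ω w ≤ 1 := discHarmonicMeasure_le_one hSm hw'
    rw [Real.rpow_def_of_pos hε]
    refine Real.exp_le_exp.2 ((le_abs_self _).trans ?_)
    rw [abs_mul, abs_neg, abs_of_nonneg h0]
    exact mul_le_of_le_one_right (abs_nonneg _) h1
  have hhM : ∀ w ∈ ball (0 : ℂ) 1, ‖h w‖ ≤ M * B := by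
    intro w hw
    rw [hhn w hw]
    exact mul_le_mul (hM w hw) (hεB w hw) (by positivity) hM0
  set A : Set ℝ := circleMap 0 1 ⁻¹' S with hA
  have hAm : MeasurableSet A := hSm.preimage (by fun_prop)
  -- Off `A` the mean of `|g|^p` is already controlled at each radius near 1. Subtracting that part
  -- leaves a function whose limit `D₁` lives on `A` and is at most 1 almost everywhere.
  set D : ℝ → ℝ → ℝ := fun r θ => ‖h (circleMap 0 r θ)‖ ^ p -
    Aᶜ.indicator (fun θ => ‖g (circleMap 0 r θ)‖ ^ p) θ with hD
  set D₁ : ℝ → ℝ := A.indicator fun θ => (‖f θ‖ * ε⁻¹) ^ p with hD₁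
  have hgc : ∀ r : ℝ, 0 < r ∧ r < 1 → Continuous fun θ => ‖g (circleMap 0 r θ)‖ ^ p :=
    fun r hr => (continuous_comp_circleMap_of_lt hg hr.1.le hr.2).norm.rpow_const
      fun _ => Or.inr hp0.le
  have hhc : ∀ r : ℝ, 0 < r ∧ r < 1 → Continuous fun θ => ‖h (circleMap 0 r θ)‖ ^ p :=
    fun r hr => (continuous_comp_circleMap_of_lt hhd hr.1.le hr.2).norm.rpow_const
      fun _ => Or.inr hp0.le
  have hDlim : Tendsto (fun r => ∫ θ, D r θ ∂angleMeasure) (𝓝[<] 1)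
      (𝓝 (∫ θ, D₁ θ ∂angleMeasure)) := by
    refine tendsto_integral_filter_of_dominated_convergence (fun _ => (M * B) ^ p + M ^ p) ?_ ?_
      (integrable_const _) ?_
    · filter_upwards [eventually_nhdsLT_one] with r hr
      exact ((hhc r hr).measurable.sub
        ((hgc r hr).measurable.indicator hAm.compl)).aestronglyMeasurable
    · filter_upwards [eventually_nhdsLT_one] with r hr
      refine Eventually.of_forall fun θ => ?_
      refine (norm_sub_le _ _).trans (add_le_add ?_ ?_)
      · rw [Real.norm_of_nonneg (by positivity)]
        exact Real.rpow_le_rpow (norm_nonneg _) (hhM _ (circleMap_mem_ball hr θ)) hp0.le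
      · refine (norm_indicator_le_norm_self _ _).trans ?_
        rw [Real.norm_of_nonneg (by positivity)]
        exact Real.rpow_le_rpow (norm_nonneg _) (hM _ (circleMap_mem_ball hr θ)) hp0.le
    · filter_upwards [ae_tendsto_radial hf hfg,
        ae_tendsto_radial (integrable_indicator_circleMap hSm) (u := ω)
          fun w _ => (discHarmonicMeasure_eq_integral w).symm] with θ h1 h2
      have h3 : Tendsto (fun r => ‖h (circleMap 0 r θ)‖ ^ p) (𝓝[<] (1 : ℝ))
          (𝓝 ((‖f θ‖ * ε ^ (-S.indicator (fun _ => (1 : ℝ)) (circleMap 0 1 θ))) ^ p)) := by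
        have h4 := (h1.norm.mul (((Real.continuous_const_rpow hε.ne').tendsto _).comp
          h2.neg)).rpow_const (p := p) (Or.inr hp0.le)
        refine h4.congr' ?_
        filter_upwards [eventually_nhdsLT_one] with r hr
        rw [hhn _ (circleMap_mem_ball hr θ), Function.comp_apply]
      by_cases hθ : θ ∈ A
      · have hθS : circleMap 0 1 θ ∈ S := hθ
        have hθ' : θ ∉ Aᶜ := by simpa using hθ
        simp only [hD, hD₁, Set.indicator_of_mem hθ, Set.indicator_of_notMem hθ', sub_zero]
        rw [Set.indicator_of_mem hθS, Real.rpow_neg_one] at h3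
        exact h3
      · have hθS : circleMap 0 1 θ ∉ S := hθ
        have hθ' : θ ∈ Aᶜ := hθ
        simp only [hD, hD₁, Set.indicator_of_notMem hθ, Set.indicator_of_mem hθ']
        rw [Set.indicator_of_notMem hθS, neg_zero, Real.rpow_zero, mul_one] at h3
        simpa using h3.sub (h1.norm.rpow_const (p := p) (Or.inr hp0.le))
  have hD₁le : ∫ θ, D₁ θ ∂angleMeasure ≤ 1 := by
    have h1 : ∫ _θ, (1 : ℝ) ∂angleMeasure = 1 := by simp
    rw [← h1]
    refine integral_mono_of_nonneg (Eventually.of_forall fun θ => ?_) (integrable_const _) ?_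
    · exact Set.indicator_nonneg (fun _ _ => by positivity) _
    · filter_upwards [ae_norm_le_of_norm_le hE hgE hf hfg] with θ hθ
      refine Set.indicator_apply_le' (fun hmem => ?_) fun _ => zero_le_one
      refine Real.rpow_le_one (by positivity) ?_ hp0.le
      rw [← div_eq_mul_inv, div_le_one hε]
      exact hθ hmem
  have hmain : ∀ C : ℝ, 1 < C → ‖h z‖ ^ p * (1 - ‖z‖ ^ 2) ≤ 1 + C := by
    intro C hC
    have h1 : Tendsto (fun r : ℝ => ‖h (r * z)‖ ^ p * (1 - ‖z‖ ^ 2)) (𝓝[<] 1)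
        (𝓝 (‖h z‖ ^ p * (1 - ‖z‖ ^ 2))) :=
      ((tendsto_dilation hhd hz).norm.rpow_const (Or.inr hp0.le)).mul_const _
    refine (le_of_tendsto_of_tendsto h1 (hDlim.add_const C) ?_).trans
      (add_le_add_left hD₁le C)
    filter_upwards [eventually_nhdsLT_one, hmean C hC] with r hr hrC
    refine (norm_rpow_mul_le_integral hhd hr.1.le hr.2 hz hp).trans ?_
    have hgi := integrable_angleMeasure_of_continuous (hgc r hr)
    have hhi := integrable_angleMeasure_of_continuous (hhc r hr)
    have h2 : ∫ θ, Aᶜ.indicator (fun θ => ‖g (circleMap 0 r θ)‖ ^ p) θ ∂angleMeasure ≤ C := by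
      refine le_trans ?_ hrC
      refine integral_mono (hgi.indicator hAm.compl) hgi fun θ => ?_
      exact Set.indicator_le_self' (fun _ _ => by positivity) θ
    have h3 : ∫ θ, D r θ ∂angleMeasure = _ := integral_sub hhi (hgi.indicator hAm.compl)
    rw [h3]
    linarith
  have hz2 : 0 < 1 - ‖z‖ ^ 2 := by nlinarith [norm_nonneg z]
  have h2 : ‖h z‖ ^ p ≤ 2 / (1 - ‖z‖ ^ 2) := by
    rw [le_div_iff₀ hz2]
    refine le_of_forall_pos_le_add fun δ hδ => ?_
    have := hmain (1 + δ) (by linarith)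
    linarith
  have h3 : ‖h z‖ ≤ (2 / (1 - ‖z‖ ^ 2)) ^ (1 / p) := by
    rw [one_div]
    exact (Real.le_rpow_inv_iff_of_pos (norm_nonneg _) (by positivity) hp0).2 h2
  have h4 : ‖g z‖ = ‖h z‖ * ε ^ ω z := by
    rw [hhn z (by simpa using hz), mul_assoc, ← Real.rpow_add hε]
    simp
  rw [h4]
  gcongr

/-- The two constants estimate for the unit ball of `H^p`, `p < ∞`. -/
theorem norm_le_rpow_discHarmonicMeasure {E : Set ℂ} (hE : E ⊆ ball (0 : ℂ) 1)
    {g : ℂ → ℂ} (hg : DifferentiableOn ℂ g (ball 0 1)) {p : ℝ} (hp : 1 ≤ p)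
    (hmean : ∀ C : ℝ, 1 < C →
      ∀ᶠ r in 𝓝[<] (1 : ℝ), ∫ θ, ‖g (circleMap 0 r θ)‖ ^ p ∂angleMeasure ≤ C)
    {ε : ℝ} (hε : 0 < ε) (hgE : ∀ ζ ∈ E, ‖g ζ‖ ≤ ε) {z : ℂ} (hz : ‖z‖ < 1) :
    ‖g z‖ ≤ (2 / (1 - ‖z‖ ^ 2)) ^ (1 / p) *
      ε ^ discHarmonicMeasure (nontangentialLimitPoints E) z := by
  have hp0 : 0 < p := by linarith
  have hgc : ∀ r : ℝ, 0 < r ∧ r < 1 → Continuous fun θ => ‖g (circleMap 0 r θ)‖ :=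
    fun r hr => (continuous_comp_circleMap_of_lt hg hr.1.le hr.2).norm
  -- From `t ≤ 1 + t ^ p` and the mean bound with `C = 2`.
  have hL1 : ∀ᶠ r in 𝓝[<] (1 : ℝ), ∫ θ, ‖g (circleMap 0 r θ)‖ ∂angleMeasure ≤ 1 + 2 := by
    filter_upwards [eventually_nhdsLT_one, hmean 2 (by norm_num)] with r hr h2
    have hi := integrable_angleMeasure_of_continuous ((hgc r hr).rpow_const (p := p)
      fun _ => Or.inr hp0.le)
    have h3 : ∫ θ, (1 + ‖g (circleMap 0 r θ)‖ ^ p) ∂angleMeasure =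
        1 + ∫ θ, ‖g (circleMap 0 r θ)‖ ^ p ∂angleMeasure := by
      rw [integral_add (integrable_const _) hi]
      simp
    have h4 : ∫ θ, ‖g (circleMap 0 r θ)‖ ∂angleMeasure ≤
        ∫ θ, (1 + ‖g (circleMap 0 r θ)‖ ^ p) ∂angleMeasure := by
      refine integral_mono (integrable_angleMeasure_of_continuous (hgc r hr))
        ((integrable_const _).add hi) fun θ => ?_
      simp only
      rcases le_total ‖g (circleMap 0 r θ)‖ 1 with h | h
      · have : 0 ≤ ‖g (circleMap 0 r θ)‖ ^ p := by positivity
        linarith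
      · have := Real.self_le_rpow_of_one_le h hp
        linarith
    linarith
  obtain ⟨U, hU, hgU⟩ := exists_norm_le_re_of_integral_le hg _ hL1
  have hU0 : ∀ w ∈ ball (0 : ℂ) 1, 0 ≤ (U w).re := fun w hw => (norm_nonneg _).trans (hgU w hw)
  set k : ℝ → ℂ → ℂ := fun η w => g w * Complex.exp (-(η : ℂ) * U w) with hk
  have hkn : ∀ η w, ‖k η w‖ = ‖g w‖ * Real.exp (-(η * (U w).re)) := by
    intro η w
    rw [hk, norm_mul, Complex.norm_exp, ← Complex.ofReal_neg, Complex.re_ofReal_mul, neg_mul]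
  have hkle : ∀ η, 0 < η → ∀ w ∈ ball (0 : ℂ) 1, ‖k η w‖ ≤ ‖g w‖ := by
    intro η hη w hw
    rw [hkn]
    refine mul_le_of_le_one_right (norm_nonneg _) ?_
    rw [Real.exp_le_one_iff]
    have := mul_nonneg hη.le (hU0 w hw)
    linarith
  -- With `t = re U ≥ |g|`, the bound is `t * exp (-η t) ≤ 1 / η`.
  have hkb : ∀ η, 0 < η → ∀ w ∈ ball (0 : ℂ) 1, ‖k η w‖ ≤ 1 / η := by
    intro η hη w hw
    rw [hkn, Real.exp_neg, ← div_eq_mul_inv, div_le_div_iff₀ (Real.exp_pos _) hη, one_mul]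
    have h1 := Real.add_one_le_exp (η * (U w).re)
    have h2 := mul_le_mul_of_nonneg_right (hgU w hw) hη.le
    linarith
  have hlim : Tendsto (fun η => ‖k η z‖) (𝓝[>] 0) (𝓝 ‖g z‖) := by
    have hc : Continuous fun η => ‖k η z‖ := by
      simp only [hkn]
      fun_prop
    have := (hc.tendsto 0).mono_left (nhdsWithin_le_nhds (s := Set.Ioi 0))
    simpa [hkn] using this
  refine le_of_tendsto hlim ?_
  filter_upwards [self_mem_nhdsWithin] with η hη
  have hkd : DifferentiableOn ℂ (k η) (ball 0 1) := hg.mul ((hU.const_mul _).cexp)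
  refine norm_le_rpow_discHarmonicMeasure_of_bounded hE hkd (hkb η hη) hp (fun C hC => ?_)
    hε (fun ζ hζ => (hkle η hη ζ (hE hζ)).trans (hgE ζ hζ)) hz
  filter_upwards [eventually_nhdsLT_one, hmean C hC] with r hr h1
  refine le_trans (integral_mono ?_ ?_ fun θ => ?_) h1
  · exact integrable_angleMeasure_of_continuous
      ((continuous_comp_circleMap_of_lt hkd hr.1.le hr.2).norm.rpow_const fun _ => Or.inr hp0.le)
  · exact integrable_angleMeasure_of_continuous
      ((hgc r hr).rpow_const fun _ => Or.inr hp0.le)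
  · exact Real.rpow_le_rpow (norm_nonneg _) (hkle η hη _ (circleMap_mem_ball hr θ)) hp0.le

/-! ### From the Hardy norm to the stability constant -/

/-- On a probability space `L^q` means are at most `L^p` means for `q ≤ p`. Allowing `q < p` is what
reaches `p = ∞`. -/
theorem eventually_integral_rpow_le_of_hardyNorm_le_one {p : ℝ≥0∞} {g : ℂ → ℂ}
    (hg : DifferentiableOn ℂ g (ball 0 1)) (hg1 : hardyNorm p g ≤ 1) {q : ℝ} (hq : 1 ≤ q)
    (hqp : ENNReal.ofReal q ≤ p) (C : ℝ) (hC : 1 < C) :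
    ∀ᶠ r in 𝓝[<] (1 : ℝ), ∫ θ, ‖g (circleMap 0 r θ)‖ ^ q ∂angleMeasure ≤ C := by
  have hq0 : 0 < q := by linarith
  have hlt : hardyNorm p g < ENNReal.ofReal (C ^ q⁻¹) := by
    refine hg1.trans_lt ?_
    rw [← ENNReal.ofReal_one]
    exact (ENNReal.ofReal_lt_ofReal_iff (by positivity)).2
      (Real.one_lt_rpow hC (inv_pos.2 hq0))
  filter_upwards [eventually_nhdsLT_one, eventually_lt_of_limsup_lt hlt] with r hr h1
  have hc := continuous_comp_circleMap_of_lt hg hr.1.le hr.2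
  have h2 : eLpNorm (fun θ => g (circleMap 0 r θ)) (ENNReal.ofReal q) angleMeasure ≤
      ENNReal.ofReal (C ^ q⁻¹) :=
    (eLpNorm_le_eLpNorm_of_exponent_le hqp hc.aestronglyMeasurable).trans h1.le
  have hm : MemLp (fun θ => g (circleMap 0 r θ)) (ENNReal.ofReal q) angleMeasure :=
    ⟨hc.aestronglyMeasurable, h2.trans_lt ENNReal.ofReal_lt_top⟩
  rw [hm.eLpNorm_eq_integral_rpow_norm (by simpa using hq0) ENNReal.ofReal_ne_top,
    ENNReal.toReal_ofReal hq0.le, ENNReal.ofReal_le_ofReal_iff (by positivity)] at h2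
  exact (Real.rpow_le_rpow_iff (integral_nonneg fun _ => by positivity) (by linarith)
    (inv_pos.2 hq0)).1 h2

theorem norm_le_of_hardyNorm_le_one {p : ℝ≥0∞} (hp : 1 ≤ p) {E : Set ℂ}
    (hE : E ⊆ ball (0 : ℂ) 1) {g : ℂ → ℂ} (hg : DifferentiableOn ℂ g (ball 0 1))
    (hg1 : hardyNorm p g ≤ 1) {ε : ℝ} (hε : 0 < ε) (hgE : ∀ ζ ∈ E, ‖g ζ‖ ≤ ε) {z : ℂ}
    (hz : ‖z‖ < 1) :
    ‖g z‖ ≤ (2 / (1 - ‖z‖ ^ 2)) ^ (1 / p).toReal *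
      ε ^ discHarmonicMeasure (nontangentialLimitPoints E) z := by
  have key : ∀ q : ℝ, 1 ≤ q → ENNReal.ofReal q ≤ p →
      ‖g z‖ ≤ (2 / (1 - ‖z‖ ^ 2)) ^ (1 / q) *
        ε ^ discHarmonicMeasure (nontangentialLimitPoints E) z := fun q hq hqp =>
    norm_le_rpow_discHarmonicMeasure hE hg hq
      (eventually_integral_rpow_le_of_hardyNorm_le_one hg hg1 hq hqp) hε hgE hz
  rcases eq_or_ne p ∞ with rfl | hp'
  · have hz2 : 0 < 1 - ‖z‖ ^ 2 := by nlinarith [norm_nonneg z]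
    -- For `p = ∞` the exponents `q = n + 1` are used; the constant tends to its zeroth power, 1.
    have h1 : Tendsto (fun n : ℕ => (2 / (1 - ‖z‖ ^ 2)) ^ (1 / ((n : ℝ) + 1)) *
        ε ^ discHarmonicMeasure (nontangentialLimitPoints E) z) atTop
        (𝓝 ((2 / (1 - ‖z‖ ^ 2)) ^ (0 : ℝ) *
          ε ^ discHarmonicMeasure (nontangentialLimitPoints E) z)) :=
      (((Real.continuous_const_rpow (by positivity)).tendsto 0).comp
        tendsto_one_div_add_atTop_nhds_zero_nat).mul_const _
    have h2 : ((1 : ℝ≥0∞) / ∞).toReal = 0 := by simp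
    rw [h2]
    exact ge_of_tendsto h1 (Eventually.of_forall fun n => key _ (by simp) le_top)
  · have h1 : (1 : ℝ) ≤ p.toReal := by
      simpa using ENNReal.toReal_mono hp' hp
    have h2 := key p.toReal h1 (ENNReal.ofReal_toReal hp').le
    rwa [ENNReal.toReal_div, ENNReal.toReal_one]

theorem hardyNorm_const {p : ℝ≥0∞} (hp : p ≠ 0) (c : ℂ) : hardyNorm p (fun _ => c) = ‖c‖ₑ := by
  have h : hardyMean p (fun _ => c) = fun _ => ‖c‖ₑ := by
    funext r
    rw [hardyMean, eLpNorm_const c hp (IsProbabilityMeasure.ne_zero _)]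
    simp
  rw [hardyNorm, h, limsup_const]

theorem ofReal_le_stabilityConstant {p : ℝ≥0∞} (hp : p ≠ 0) (E : Set ℂ) {ε R : ℝ} (hε : 0 ≤ ε)
    (hε₁ : ε ≤ 1) (hR : 0 ≤ R) : ENNReal.ofReal ε ≤ stabilityConstant p E ε R := by
  have hn : ‖(ε : ℂ)‖ = ε := by rw [Complex.norm_real, Real.norm_of_nonneg hε]
  have he : ‖(ε : ℂ)‖ₑ = ENNReal.ofReal ε := by rw [← ofReal_norm, hn]
  have hmem : (fun _ : ℂ => (ε : ℂ)) ∈ {g : ℂ → ℂ | MemHardy p g ∧ hardyNorm p g ≤ 1 ∧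
      ∀ ζ ∈ E, ‖g ζ‖ ≤ ε} := by
    refine ⟨⟨differentiableOn_const _, ?_⟩, ?_, fun _ _ => hn.le⟩
    · rw [hardyNorm_const hp, he]
      exact ENNReal.ofReal_lt_top
    · rw [hardyNorm_const hp, he]
      exact ENNReal.ofReal_le_one.2 hε₁
  rw [← he]
  exact (le_iSup₂ (f := fun z (_ : z ∈ closedBall (0 : ℂ) R) => ‖(ε : ℂ)‖ₑ) 0 (by simpa)).trans
    (le_iSup₂ (f := fun (g : ℂ → ℂ) (_ : g ∈ {g : ℂ → ℂ | MemHardy p g ∧ hardyNorm p g ≤ 1 ∧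
      ∀ ζ ∈ E, ‖g ζ‖ ≤ ε}) => ⨆ z ∈ closedBall (0 : ℂ) R, ‖g z‖ₑ) _ hmem)

theorem mainTheorem7 (p : ENNReal) (hp : 1 ≤ p) (E : Set ℂ) (hE : E ⊆ Metric.ball (0 : ℂ) 1)
    (hE₀ : 0 < circleMeasure (nontangentialLimitPoints E))
    (R : ℝ) (hR₀ : 0 < R) (hR₁ : R < 1) (ε : ℝ) (hε : 0 < ε) :
    (ε ≤ 1 → ENNReal.ofReal ε ≤ stabilityConstant p E ε R) ∧
    stabilityConstant p E ε R ≤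
      ENNReal.ofReal ((2 : ℝ) ^ (1 / p).toReal / (1 - R ^ 2) ^ (1 / p).toReal) *
        ⨆ z ∈ Metric.closedBall (0 : ℂ) R,
          ENNReal.ofReal (ε ^ discHarmonicMeasure (nontangentialLimitPoints E) z) := by
  have hp0 : p ≠ 0 := (zero_lt_one.trans_le hp).ne'
  refine ⟨fun hε₁ => ofReal_le_stabilityConstant hp0 E hε.le hε₁ hR₀.le, ?_⟩
  have hR2 : 0 < 1 - R ^ 2 := by nlinarith
  refine iSup₂_le fun g hg => iSup₂_le fun z hz => ?_
  obtain ⟨⟨hgd, -⟩, hg1, hgE⟩ := hg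
  have hzR : ‖z‖ ≤ R := by simpa using hz
  have h1 := norm_le_of_hardyNorm_le_one hp hE hgd hg1 hε hgE (hzR.trans_lt hR₁)
  have h2 : (2 / (1 - ‖z‖ ^ 2)) ^ (1 / p).toReal ≤
      (2 : ℝ) ^ (1 / p).toReal / (1 - R ^ 2) ^ (1 / p).toReal := by
    rw [← Real.div_rpow zero_le_two hR2.le]
    gcongr
    have : ‖z‖ ^ 2 ≤ R ^ 2 := by gcongr
    exact div_nonneg zero_le_two (by linarith)
  refine le_trans ?_ (mul_le_mul_right (le_iSup₂ (f := fun z (_ : z ∈ closedBall (0 : ℂ) R) =>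
    ENNReal.ofReal (ε ^ discHarmonicMeasure (nontangentialLimitPoints E) z)) z hz) _)
  rw [← ENNReal.ofReal_mul (by positivity), ← ofReal_norm]
  refine ENNReal.ofReal_le_ofReal (h1.trans ?_)
  gcongr
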